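/- For $n\ge 3$, a cycle on $[n]=\{1,\dots,n\}$ is an undirected Hamiltonian cycle of the complete graph with vertex set $[n]$. For a cycle $A_n$ on $[n]$ and $3\le m\le n$ let $A_m$ be the cycle on $[m]$ obtained from $A_n$ by successively suppressing the nodes $n,n-1,\dots,m+1$ (suppressing a node means deleting it and joining its two neighbours); equivalently, $A_n$ arises from $A_m$ by successively inserting the nodes $m+1,\dots,n$ into cycle-edges. Let $\nu_A(k)$ be the set of the two neighbours of $k$ in $A_k$ if $k\ge 3$ (for $k\ge4$, the ends of the cycle-edge of $A_{k-1}$ into which $k$ is inserted), and let $\nu_A(2)=\{1\}$, $\nu_A(1)=\emptyset$. For two cycles $A_n,B_n$ on $[n]$, the pedigree graph $G^{AB}_n$ is the following graph. Its vertices are the $k\in[n]$ with $\nu_A(k)\ne\nu_B(k)$. Two vertices $k<m$ are adjacent if and only if, for $(P,Q)=(A,B)$ or $(P,Q)=(B,A)$, at least one of the following holds: (type 1) $\nu_P(m)=\nu_Q(k)$; (type 2) $k=\max\nu_P(m)$ and $\nu_Q(k)\cap\nu_P(m)=\emptyset$. Theorem. For every $\varepsilon>0$ there is an integer $N$ such that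 for all $n\ge N$ and all cycles $A_n$ on $[n]$: if $B_n$ is drawn uniformly at random from all cycles on $[n]$, then \[ \Pr\bigl(G^{AB}_n\text{ is connected}\bigr)\ \ge\ 1-\varepsilon , \] where connected means having exactly one connected component (in particular, the graph without vertices, which occurs only for $B_n=A_n$, does not count as connected). -/

import Mathlib

namespace Pedigree

/-- `G` is a cycle with node set `[n] = {1, …, n}`: a graph on `ℕ` all of whose edges lie inside
`[n]` and which restricted to `[n]` is an (undirected) cycle of length `n ≥ 3`. -/
def IsCycleOn (n : ℕ) (G : SimpleGraph ℕ) : Prop :=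
  3 ≤ n ∧ G.support ⊆ Set.Icc 1 n ∧
    Nonempty (G.induce (Set.Icc 1 n) ≃g SimpleGraph.cycleGraph n)

/-- The (finite) type of all cycles with node set `[n]`. -/
def CycleOn (n : ℕ) : Type := {G : SimpleGraph ℕ // IsCycleOn n G}

instance (n : ℕ) : Finite (CycleOn n) := by
  refine Finite.of_injective
    (fun A : CycleOn n => (A.1.induce (Set.Icc 1 n) : SimpleGraph (Set.Icc 1 n))) ?_
  intro A B hAB
  have key : ∀ C D : CycleOn n,
      C.1.induce (Set.Icc 1 n) = D.1.induce (Set.Icc 1 n) →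
        ∀ x y, C.1.Adj x y → D.1.Adj x y := by
    intro C D h x y hxy
    have hx : x ∈ Set.Icc 1 n := C.2.2.1 ⟨y, hxy⟩
    have hy : y ∈ Set.Icc 1 n := C.2.2.1 ⟨x, hxy.symm⟩
    have h' : (C.1.induce (Set.Icc 1 n)).Adj ⟨x, hx⟩ ⟨y, hy⟩ := hxy
    rw [h] at h'
    exact h'
  apply Subtype.ext
  ext x y
  exact ⟨key A B hAB x y, key B A hAB.symm x y⟩

/-- Every set of cycles is an event. -/
instance (n : ℕ) : MeasurableSpace (CycleOn n) := ⊤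

/-- Undo the insertion of the node `m` into a cycle: delete `m` and join its two neighbours. -/
def suppress (m : ℕ) (G : SimpleGraph ℕ) : SimpleGraph ℕ where
  Adj x y := x ≠ y ∧ x ≠ m ∧ y ≠ m ∧ (G.Adj x y ∨ (G.Adj x m ∧ G.Adj y m))
  symm := ⟨fun _ _ ⟨h, hx, hy, hG⟩ => ⟨h.symm, hy, hx, hG.imp (fun e => e.symm) And.symm⟩⟩
  loopless := ⟨fun _ h => h.1 rfl⟩

/-- The stage `A_m`, `m ≤ n`, of the evolution of a cycle `A = A_n` with node set `[n]`: the cycle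
with node set `[m]` from which `A_n` arises by successively inserting `m + 1, …, n`, i.e. the
result of suppressing `n, n - 1, …, m + 1` in this order. (For `m = 2` it is the single edge
`{1, 2}`, for `m = 1` it has no edges.) -/
def stage : ℕ → SimpleGraph ℕ → ℕ → SimpleGraph ℕ
  | 0, G, _ => G
  | n + 1, G, m => if n + 1 ≤ m then G else stage n (suppress (n + 1) G) m

/-- `ν_A(k)` for `k ∈ [n]`: the set of neighbours of `k` in `A_k`. For `k ≥ 4` these are the two
ends of the cycle-edge of `A_{k-1}` into which `k` was inserted; further `ν_A(3) = {1, 2}`,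
`ν_A(2) = {1}` and `ν_A(1) = ∅`. -/
def nu {n : ℕ} (A : CycleOn n) (k : ℕ) : Set ℕ := (stage n A.1 k).neighborSet k

/-- The vertices of the pedigree graph: the nodes `k ∈ [n]` with `ν_A(k) ≠ ν_B(k)`. -/
def pedigreeVertices {n : ℕ} (A B : CycleOn n) : Set ℕ :=
  {k | k ∈ Set.Icc 1 n ∧ nu A k ≠ nu B k}

/-- Type-1 edge "from `A` to `B`" between `m` and the earlier `k`. -/
def IsType1 {n : ℕ} (A B : CycleOn n) (m k : ℕ) : Prop :=
  k < m ∧ nu A m = nu B k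

/-- Type-2 edge "from `A` to `B`" between `m` and the earlier `l = max ν_A(m)`. -/
def IsType2 {n : ℕ} (A B : CycleOn n) (m l : ℕ) : Prop :=
  l < m ∧ IsGreatest (nu A m) l ∧ nu B l ∩ nu A m = ∅

/-- The pedigree graph `G_n^{AB}` of two cycles with node set `[n]`. -/
def pedigreeGraph {n : ℕ} (A B : CycleOn n) : SimpleGraph (pedigreeVertices A B) :=
  SimpleGraph.fromRel fun x y =>
    IsType1 A B x y ∨ IsType1 B A x y ∨ IsType2 A B x y ∨ IsType2 B A x y

end Pedigree

/-!
The cycle `A` is fixed and `B` is built up by inserting each node `n + 1` into a uniformly random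
edge of the current cycle on `[n]`; the proof follows the number of connected components of the
pedigree graph during this process.

*Components.* A pair of nodes of `[n]` that is not an edge of the current cycle `Q` has an anchor
(`IsAnchor`, `exists_isAnchor`): an earlier node which is adjacent in the pedigree graph to the
next node, if the other cycle inserts that node into this pair. Hence, when `A` and `B` insert
`n + 1` into different edges, `n + 1` is a new vertex which is adjacent to an old one unless both
these edges are common to the two current cycles (`IsNew`). Only in that case does the number of
components grow, and then by one (`numComp_le_add_one`, `numComp_le_of_not_isNew`). Moreover every
component contains an anchor of an edge of the current `B` (`exists_reachable_isAnchor`). So if `A`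
inserts `n + 1` into an edge that is not common, which attaches `n + 1` to one component, and there
is a second component, then at least one of the `n` possible insertions into `B` merges these two
(`exists_numComp_lt`).

*Probabilities.* A given pair of nodes is an edge of the random cycle on `[n]` with probability at
most `2 / (n - 1)`, and two given pairs are both edges with probability at most
`4 / ((n - 1) (n - 2))`. Summing the latter over the edges of `A` shows that a component is created
with probability `O(1 / n ^ 2)` (`prob_isNew_le`), which is summable. Let `p n` be the probability
of at least two components at stage `n`. Then `p` can increase from one stage to later ones only
by the tail of a convergent series (`prob_two_le_numComp_succ_le`), while the expected number of
components changes at stage `n` by at most `O(1 / n ^ 2) - p n / n` (`avg_numComp_succ_le`). As this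
expectation stays nonnegative, `p n` times the harmonic sum up to `n` is bounded
(`prob_two_le_numComp_mul_sum_le`), so `p n → 0` uniformly in `A`. Finally, the pedigree graph has no
component at all only if `B = A`, which has vanishing probability.
-/

namespace Pedigree

/-! ### Cycles as cyclic orders -/

/-- `σ 0, …, σ (n - 1)` lists the nodes of the cycle `G` on `[n]` in cyclic order; the values of
`σ` outside `{0, …, n - 1}` are irrelevant. -/
structure CyclicOrder (n : ℕ) (G : SimpleGraph ℕ) (σ : ℕ → ℕ) : Prop where
  three_le : 3 ≤ n
  inj : ∀ i < n, ∀ j < n, σ i = σ j → i = j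
  mem : ∀ i < n, σ i ∈ Set.Icc 1 n
  surj : ∀ x ∈ Set.Icc 1 n, ∃ i < n, σ i = x
  supp : ∀ x y, G.Adj x y → x ∈ Set.Icc 1 n
  adj : ∀ i < n, ∀ j < n,
    G.Adj (σ i) (σ j) ↔ i + 1 = j ∨ j + 1 = i ∨ (i = 0 ∧ j + 1 = n) ∨ (j = 0 ∧ i + 1 = n)

theorem cycleGraph_adj_iff_val {n : ℕ} (hn : 3 ≤ n) (u v : Fin n) :
    (SimpleGraph.cycleGraph n).Adj u v ↔
      u.1 + 1 = v.1 ∨ v.1 + 1 = u.1 ∨ (u.1 = 0 ∧ v.1 + 1 = n) ∨ (v.1 = 0 ∧ u.1 + 1 = n) := by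
  rw [SimpleGraph.cycleGraph_adj']
  have hu := u.2
  have hv := v.2
  rcases le_or_gt u v with h | h
  · rcases h.eq_or_lt with rfl | h'
    · have : NeZero n := ⟨by omega⟩
      simp only [sub_self, Fin.val_zero]
      omega
    · rw [Fin.sub_val_of_le h, Fin.coe_sub_iff_lt.2 h']
      have : u.1 < v.1 := h'
      omega
  · rw [Fin.sub_val_of_le h.le, Fin.coe_sub_iff_lt.2 h]
    have : v.1 < u.1 := h
    omega

theorem IsCycleOn.exists_cyclicOrder {n : ℕ} {G : SimpleGraph ℕ} (h : IsCycleOn n G) :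
    ∃ σ, CyclicOrder n G σ := by
  obtain ⟨hn, hs, ⟨φ⟩⟩ := h
  refine ⟨fun i => if hi : i < n then (φ.symm ⟨i, hi⟩).1 else 0, hn, ?_, ?_, ?_, ?_, ?_⟩
  · intro i hi j hj hij
    simp only [hi, hj, dif_pos] at hij
    have := φ.symm.injective (Subtype.ext hij)
    simpa using this
  · intro i hi
    simp only [hi, dif_pos]
    exact (φ.symm ⟨i, hi⟩).2
  · intro x hx
    refine ⟨(φ ⟨x, hx⟩).1, (φ ⟨x, hx⟩).2, ?_⟩
    simp
  · intro x y hxy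
    exact hs ⟨y, hxy⟩
  · intro i hi j hj
    simp only [hi, hj, dif_pos]
    have := φ.symm.map_adj_iff (v := ⟨i, hi⟩) (w := ⟨j, hj⟩)
    rw [cycleGraph_adj_iff_val hn] at this
    exact this

theorem CyclicOrder.isCycleOn {n : ℕ} {G : SimpleGraph ℕ} {σ : ℕ → ℕ} (h : CyclicOrder n G σ) :
    IsCycleOn n G := by
  refine ⟨h.three_le, ?_, ?_⟩
  · rintro x ⟨y, hxy⟩
    exact h.supp x y hxy
  · refine ⟨SimpleGraph.Iso.symm
      ⟨Equiv.ofBijective (fun i : Fin n => (⟨σ i.1, h.mem i.1 i.2⟩ : Set.Icc 1 n)) ⟨?_, ?_⟩, ?_⟩⟩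
    · intro i j hij
      exact Fin.ext (h.inj _ i.2 _ j.2 (congrArg Subtype.val hij))
    · rintro ⟨x, hx⟩
      obtain ⟨i, hi, rfl⟩ := h.surj x hx
      exact ⟨⟨i, hi⟩, rfl⟩
    · intro i j
      rw [cycleGraph_adj_iff_val h.three_le]
      exact h.adj _ i.2 _ j.2

theorem CyclicOrder.rotate {n : ℕ} {G : SimpleGraph ℕ} {σ : ℕ → ℕ} (h : CyclicOrder n G σ)
    {c : ℕ} (hc : c < n) :
    CyclicOrder n G (fun i => σ (if i + c < n then i + c else i + c - n)) := by
  have h3 := h.three_le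
  refine ⟨h3, ?_, ?_, ?_, h.supp, ?_⟩
  · intro i hi j hj hij
    have := h.inj _ (by split_ifs <;> omega) _ (by split_ifs <;> omega) hij
    split_ifs at this <;> omega
  · intro i hi
    exact h.mem _ (by split_ifs <;> omega)
  · intro x hx
    obtain ⟨i, hi, rfl⟩ := h.surj x hx
    refine ⟨if c ≤ i then i - c else i + n - c, by split_ifs <;> omega, ?_⟩
    congr 1
    split_ifs <;> omega
  · intro i hi j hj
    rw [h.adj _ (by split_ifs <;> omega) _ (by split_ifs <;> omega)]
    split_ifs <;> omega

theorem IsCycleOn.exists_cyclicOrder_last {n : ℕ} {G : SimpleGraph ℕ} (h : IsCycleOn n G) {x : ℕ}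
    (hx : x ∈ Set.Icc 1 n) : ∃ σ, CyclicOrder n G σ ∧ σ (n - 1) = x := by
  obtain ⟨σ, hσ⟩ := h.exists_cyclicOrder
  obtain ⟨i, hi, rfl⟩ := hσ.surj x hx
  by_cases hin : i + 1 = n
  · exact ⟨σ, hσ, by subst hin; rfl⟩
  · refine ⟨_, hσ.rotate (c := i + 1) (by omega), ?_⟩
    congr 1
    split_ifs <;> omega

/-- In a cyclic order ending in `x` the neighbours of `x` are the first and the penultimate
node. -/
theorem CyclicOrder.adj_last_iff {n : ℕ} {G : SimpleGraph ℕ} {σ : ℕ → ℕ} (h : CyclicOrder n G σ)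
    (y : ℕ) : G.Adj (σ (n - 1)) y ↔ y = σ 0 ∨ y = σ (n - 2) := by
  have h3 := h.three_le
  constructor
  · intro hy
    obtain ⟨j, hj, rfl⟩ := h.surj y (h.supp _ _ hy.symm)
    have := (h.adj _ (by omega) _ hj).1 hy
    have : j = 0 ∨ j = n - 2 := by omega
    exact this.imp (congrArg σ) (congrArg σ)
  · rintro (rfl | rfl) <;> exact (h.adj _ (by omega) _ (by omega)).2 (by omega)

/-- The ends of an edge of a cycle are, in one of the two orders, the last and the first node of
some cyclic order of the cycle. -/
theorem IsCycleOn.exists_cyclicOrder_of_adj {n : ℕ} {G : SimpleGraph ℕ} (h : IsCycleOn n G)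
    {a b : ℕ} (hab : G.Adj a b) :
    ∃ σ, CyclicOrder n G σ ∧
      ((σ (n - 1) = a ∧ σ 0 = b) ∨ (σ (n - 1) = b ∧ σ 0 = a)) := by
  obtain ⟨σ, hσ, rfl⟩ := h.exists_cyclicOrder_last (h.2.1 ⟨b, hab⟩)
  have h3 := hσ.three_le
  rcases (hσ.adj_last_iff b).1 hab with rfl | rfl
  · exact ⟨σ, hσ, Or.inl ⟨rfl, rfl⟩⟩
  · refine ⟨_, hσ.rotate (c := n - 1) (by omega), Or.inr ⟨?_, ?_⟩⟩
    · congr 1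
      split_ifs <;> omega
    · congr 1
      split_ifs <;> omega

theorem IsCycleOn.mem_left {n : ℕ} {G : SimpleGraph ℕ} (h : IsCycleOn n G) {x y : ℕ}
    (hxy : G.Adj x y) : x ∈ Set.Icc 1 n := h.2.1 ⟨y, hxy⟩

theorem IsCycleOn.exists_neighbors {n : ℕ} {G : SimpleGraph ℕ} (h : IsCycleOn n G) {x : ℕ}
    (hx : x ∈ Set.Icc 1 n) : ∃ a b, a ≠ b ∧ ∀ y, G.Adj x y ↔ y = a ∨ y = b := by
  obtain ⟨σ, hσ, rfl⟩ := h.exists_cyclicOrder_last hx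
  have h3 := hσ.three_le
  refine ⟨σ 0, σ (n - 2), fun h' => ?_, hσ.adj_last_iff⟩
  have := hσ.inj _ (by omega) _ (by omega) h'
  omega

/-- Two neighbours of the same node of a cycle of length at least four are not adjacent. -/
theorem IsCycleOn.not_adj_of_adj_adj {n : ℕ} {G : SimpleGraph ℕ} (h : IsCycleOn n G) (hn : 4 ≤ n)
    {x a b : ℕ} (ha : G.Adj x a) (hb : G.Adj x b) : ¬ G.Adj a b := by
  intro hab
  obtain ⟨σ, hσ, rfl⟩ := h.exists_cyclicOrder_last (h.mem_left ha)
  rw [hσ.adj_last_iff] at ha hb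
  rcases ha with rfl | rfl <;> rcases hb with rfl | rfl
  · exact hab.ne rfl
  · have := (hσ.adj _ (by omega) _ (by omega)).1 hab
    omega
  · have := (hσ.adj _ (by omega) _ (by omega)).1 hab
    omega
  · exact hab.ne rfl

theorem IsCycleOn.adj_iff_of_three {G : SimpleGraph ℕ} (h : IsCycleOn 3 G) (x y : ℕ) :
    G.Adj x y ↔ x ≠ y ∧ x ∈ Set.Icc 1 3 ∧ y ∈ Set.Icc 1 3 := by
  refine ⟨fun hxy => ⟨hxy.ne, h.mem_left hxy, h.mem_left hxy.symm⟩, ?_⟩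
  rintro ⟨hne, hx, hy⟩
  obtain ⟨σ, hσ⟩ := h.exists_cyclicOrder
  obtain ⟨i, hi, rfl⟩ := hσ.surj x hx
  obtain ⟨j, hj, rfl⟩ := hσ.surj y hy
  have : i ≠ j := fun h' => hne (congrArg σ h')
  exact (hσ.adj _ hi _ hj).2 (by omega)

theorem IsCycleOn.suppress {n : ℕ} {G : SimpleGraph ℕ} (hn : 3 ≤ n) (h : IsCycleOn (n + 1) G) :
    IsCycleOn n (suppress (n + 1) G) := by
  obtain ⟨σ, hσ, hlast⟩ := h.exists_cyclicOrder_last (x := n + 1) ⟨by omega, le_rfl⟩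
  simp only [Nat.add_sub_cancel] at hlast
  have hne : ∀ i < n, σ i ≠ n + 1 := by
    intro i hi h'
    have := hσ.inj i (by omega) n (by omega) (h'.trans hlast.symm)
    omega
  refine CyclicOrder.isCycleOn (σ := σ) ⟨hn, ?_, ?_, ?_, ?_, ?_⟩
  · exact fun i hi j hj => hσ.inj i (by omega) j (by omega)
  · intro i hi
    have h1 := hσ.mem i (by omega)
    have h2 := hne i hi
    simp only [Set.mem_Icc] at h1 ⊢
    omega
  · intro x hx
    obtain ⟨i, hi, rfl⟩ := hσ.surj x ⟨hx.1, hx.2.trans (by omega)⟩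
    refine ⟨i, ?_, rfl⟩
    by_contra hcon
    have hin : i = n := by omega
    have := hx.2
    rw [hin, hlast] at this
    omega
  · rintro x y ⟨-, hx, -, hadj⟩
    have h1 : x ∈ Set.Icc 1 (n + 1) := by
      rcases hadj with hadj | ⟨hadj, -⟩ <;> exact hσ.supp _ _ hadj
    simp only [Set.mem_Icc] at h1 ⊢
    omega
  · intro i hi j hj
    have h1 := hσ.adj i (by omega) j (by omega)
    have h2 := hσ.adj i (by omega) n (by omega)
    have h3 := hσ.adj j (by omega) n (by omega)
    rw [hlast] at h2 h3
    have h4 : σ i = σ j ↔ i = j := ⟨hσ.inj i (by omega) j (by omega), congrArg σ⟩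
    simp only [Pedigree.suppress, h1, h2, h3, ne_eq, h4, hne i hi, hne j hj, not_false_eq_true,
      true_and]
    clear h1 h2 h3 h4
    grind

/-- Insert the node `m` into the edge `e` of `G`. -/
def insertNode (m : ℕ) (e : Sym2 ℕ) (G : SimpleGraph ℕ) : SimpleGraph ℕ where
  Adj x y := x ≠ y ∧ ((x ≠ m ∧ y ≠ m ∧ G.Adj x y ∧ s(x, y) ≠ e) ∨ (x = m ∧ y ∈ e) ∨
    (y = m ∧ x ∈ e))
  symm := ⟨fun x y ⟨h, h'⟩ => ⟨h.symm, by
    rw [Sym2.eq_swap, G.adj_comm]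
    tauto⟩⟩
  loopless := ⟨fun _ h => h.1 rfl⟩

theorem IsCycleOn.insertNode {n : ℕ} {G : SimpleGraph ℕ} (h : IsCycleOn n G) {e : Sym2 ℕ}
    (he : e ∈ G.edgeSet) : IsCycleOn (n + 1) (insertNode (n + 1) e G) := by
  induction e with
  | _ a b =>
  rw [SimpleGraph.mem_edgeSet] at he
  obtain ⟨σ, hσ, hends⟩ := h.exists_cyclicOrder_of_adj he
  have hn := hσ.three_le
  have hab : s(a, b) = s(σ 0, σ (n - 1)) := by
    rcases hends with ⟨rfl, rfl⟩ | ⟨rfl, rfl⟩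
    · exact Sym2.eq_swap
    · rfl
  rw [hab]
  clear hab
  have hlt : ∀ i < n, σ i < n + 1 := fun i hi => Nat.lt_succ_of_le (hσ.mem i hi).2
  refine CyclicOrder.isCycleOn (σ := fun i => if i < n then σ i else n + 1)
    ⟨by omega, ?_, ?_, ?_, ?_, ?_⟩
  · intro i hi j hj hij
    have h1 := hlt i
    have h2 := hlt j
    by_cases hi' : i < n <;> by_cases hj' : j < n <;>
      simp only [hi', hj', if_true, if_false] at hij
    · exact hσ.inj i hi' j hj' hij
    · have := h1 hi'; omega
    · have := h2 hj'; omega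
    · omega
  · intro i hi
    by_cases hi' : i < n <;> simp only [hi', if_true, if_false]
    · have := hσ.mem i hi'
      exact ⟨this.1, this.2.trans (by omega)⟩
    · exact ⟨by omega, le_rfl⟩
  · intro x hx
    by_cases hx' : x = n + 1
    · exact ⟨n, by omega, by simp [hx']⟩
    · obtain ⟨i, hi, rfl⟩ := hσ.surj x ⟨hx.1, by have := hx.2; omega⟩
      exact ⟨i, by omega, by simp [hi]⟩
  · rintro x y ⟨-, ⟨-, -, hxy, -⟩ | ⟨rfl, -⟩ | ⟨-, hx⟩⟩
    · have := hσ.supp _ _ hxy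
      exact ⟨this.1, this.2.trans (by omega)⟩
    · exact ⟨by omega, le_rfl⟩
    · rw [Sym2.mem_iff] at hx
      rcases hx with rfl | rfl
      · have := hσ.mem 0 (by omega)
        exact ⟨this.1, this.2.trans (by omega)⟩
      · have := hσ.mem (n - 1) (by omega)
        exact ⟨this.1, this.2.trans (by omega)⟩
  · intro i hi j hj
    have key : ∀ i < n, ∀ j < n, σ i = σ j ↔ i = j :=
      fun i hi j hj => ⟨hσ.inj i hi j hj, congrArg σ⟩
    have hne : ∀ i < n, σ i ≠ n + 1 := fun i hi => (hlt i hi).ne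
    have hne' : ∀ i < n, n + 1 ≠ σ i := fun i hi => (hlt i hi).ne'
    by_cases hi' : i < n <;> by_cases hj' : j < n <;>
      simp only [hi', hj', if_true, if_false, Pedigree.insertNode, Sym2.mem_iff]
    · rw [hσ.adj i hi' j hj']
      simp only [ne_eq, Sym2.eq_iff, key i hi' j hj', hne i hi', hne j hj', key i hi' 0 (by omega),
        key j hj' 0 (by omega), key i hi' (n - 1) (by omega), key j hj' (n - 1) (by omega)]
      grind
    · simp only [ne_eq, hne i hi', key i hi' 0 (by omega), key i hi' (n - 1) (by omega)]
      simp only [not_true, not_false_eq_true, false_and, and_false, true_and, false_or]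
      grind
    · simp only [ne_eq, hne j hj', hne' j hj', key j hj' 0 (by omega),
        key j hj' (n - 1) (by omega)]
      simp only [not_true, not_false_eq_true, false_and, true_and, or_false, false_or]
      grind
    · simp
      omega

/-! ### Insertion of the last node -/

noncomputable instance (n : ℕ) : Fintype (CycleOn n) := Fintype.ofFinite _

/-- The cycle on `[n]` obtained from a cycle on `[n + 1]` by suppressing the node `n + 1`. -/
def red {n : ℕ} (hn : 3 ≤ n) (C : CycleOn (n + 1)) : CycleOn n :=
  ⟨suppress (n + 1) C.1, IsCycleOn.suppress hn C.2⟩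

theorem CycleOn.three_le {n : ℕ} (C : CycleOn n) : 3 ≤ n := C.2.1

theorem CycleOn.exists_lastEdge {n : ℕ} (C : CycleOn n) :
    ∃ e : Sym2 ℕ, ∀ y, y ∈ e ↔ C.1.Adj n y := by
  have := C.three_le
  obtain ⟨a, b, -, h⟩ := C.2.exists_neighbors (x := n) ⟨by omega, le_rfl⟩
  exact ⟨s(a, b), fun y => by rw [h, Sym2.mem_iff]⟩

/-- The unordered pair of the neighbours of the last node `n` of a cycle on `[n]`, that is (for
`n ≥ 4`), the edge into which `n` is inserted. -/
noncomputable def lastEdge {n : ℕ} (C : CycleOn n) : Sym2 ℕ := C.exists_lastEdge.choose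

theorem mem_lastEdge {n : ℕ} (C : CycleOn n) {y : ℕ} : y ∈ lastEdge C ↔ C.1.Adj n y :=
  C.exists_lastEdge.choose_spec y

theorem exists_lastEdge_eq {n : ℕ} (C : CycleOn n) : ∃ a b, a ≠ b ∧ lastEdge C = s(a, b) := by
  have := C.three_le
  obtain ⟨a, b, hab, h⟩ := C.2.exists_neighbors (x := n) ⟨by omega, le_rfl⟩
  exact ⟨a, b, hab, Sym2.ext fun y => by rw [mem_lastEdge, h, Sym2.mem_iff]⟩

theorem mem_Icc_of_mem_edge {n : ℕ} (C : CycleOn n) {e : Sym2 ℕ} (he : e ∈ C.1.edgeSet) {x : ℕ}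
    (hx : x ∈ e) : x ∈ Set.Icc 1 n := by
  obtain ⟨y, rfl⟩ := Sym2.mem_iff_exists.1 hx
  exact C.2.mem_left he

theorem mk_last_mem_edgeSet {n : ℕ} (C : CycleOn n) {x : ℕ} :
    s(n, x) ∈ C.1.edgeSet ↔ x ∈ lastEdge C := (mem_lastEdge C).symm

theorem notMem_of_mem_edge {n : ℕ} (C : CycleOn n) {e : Sym2 ℕ} (he : e ∈ C.1.edgeSet) :
    n + 1 ∉ e := fun h => by
  have := (mem_Icc_of_mem_edge C he h).2
  omega

theorem lastEdge_notMem_edgeSet {n : ℕ} (hn : 3 ≤ n) (C : CycleOn (n + 1)) :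
    lastEdge C ∉ C.1.edgeSet := by
  obtain ⟨a, b, hab, h⟩ := exists_lastEdge_eq C
  have ha := (mem_lastEdge C).1 (h ▸ Sym2.mem_mk_left a b)
  have hb := (mem_lastEdge C).1 (h ▸ Sym2.mem_mk_right a b)
  rw [h]
  exact C.2.not_adj_of_adj_adj (by omega) ha hb

theorem lastEdge_mem_red {n : ℕ} (hn : 3 ≤ n) (C : CycleOn (n + 1)) :
    lastEdge C ∈ (red hn C).1.edgeSet := by
  obtain ⟨a, b, hab, h⟩ := exists_lastEdge_eq C
  have ha := (mem_lastEdge C).1 (h ▸ Sym2.mem_mk_left a b)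
  have hb := (mem_lastEdge C).1 (h ▸ Sym2.mem_mk_right a b)
  rw [h]
  exact ⟨hab, ha.ne', hb.ne', Or.inr ⟨ha.symm, hb.symm⟩⟩

theorem mem_edgeSet_iff_red {n : ℕ} (hn : 3 ≤ n) (C : CycleOn (n + 1)) {e : Sym2 ℕ}
    (he : n + 1 ∉ e) : e ∈ C.1.edgeSet ↔ e ∈ (red hn C).1.edgeSet ∧ e ≠ lastEdge C := by
  constructor
  · intro h
    refine ⟨?_, fun h' => lastEdge_notMem_edgeSet hn C (h' ▸ h)⟩
    induction e with
    | _ a b =>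
    rw [Sym2.mem_iff, not_or] at he
    exact ⟨h.ne, Ne.symm he.1, Ne.symm he.2, Or.inl h⟩
  · rintro ⟨h, hne⟩
    induction e with
    | _ a b =>
    obtain ⟨hab, -, -, h | ⟨ha, hb⟩⟩ := h
    · exact h
    · exact absurd ((Sym2.mem_and_mem_iff hab).1
        ⟨(mem_lastEdge C).2 ha.symm, (mem_lastEdge C).2 hb.symm⟩).symm hne

theorem eq_of_red_eq_of_lastEdge_eq {n : ℕ} (hn : 3 ≤ n) {C D : CycleOn (n + 1)}
    (h : red hn C = red hn D) (h' : lastEdge C = lastEdge D) : C = D := by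
  refine Subtype.ext (SimpleGraph.edgeSet_injective ?_)
  ext e
  by_cases he : n + 1 ∈ e
  · obtain ⟨x, rfl⟩ := Sym2.mem_iff_exists.1 he
    rw [mk_last_mem_edgeSet, mk_last_mem_edgeSet, h']
  · rw [mem_edgeSet_iff_red hn C he, mem_edgeSet_iff_red hn D he, h, h']

theorem exists_red_eq_lastEdge_eq {n : ℕ} (hn : 3 ≤ n) (B : CycleOn n) {e : Sym2 ℕ}
    (he : e ∈ B.1.edgeSet) : ∃ C : CycleOn (n + 1), red hn C = B ∧ lastEdge C = e := by
  have hlast : ∀ x, (insertNode (n + 1) e B.1).Adj (n + 1) x ↔ x ∈ e := by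
    intro x
    constructor
    · rintro ⟨hne, ⟨h, -⟩ | ⟨-, h⟩ | ⟨h, -⟩⟩
      · exact absurd rfl h
      · exact h
      · exact absurd h.symm hne
    · intro hx
      refine ⟨?_, Or.inr (Or.inl ⟨rfl, hx⟩)⟩
      rintro rfl
      exact notMem_of_mem_edge B he hx
  refine ⟨⟨_, B.2.insertNode he⟩, ?_, ?_⟩
  · refine Subtype.ext ?_
    ext x y
    change x ≠ y ∧ x ≠ n + 1 ∧ y ≠ n + 1 ∧ ((insertNode (n + 1) e B.1).Adj x y ∨
      ((insertNode (n + 1) e B.1).Adj x (n + 1) ∧ (insertNode (n + 1) e B.1).Adj y (n + 1))) ↔ _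
    rw [SimpleGraph.adj_comm _ x (n + 1), SimpleGraph.adj_comm _ y (n + 1), hlast, hlast]
    constructor
    · rintro ⟨hne, hx, hy, ⟨-, ⟨-, -, h, -⟩ | ⟨h, -⟩ | ⟨h, -⟩⟩ | h⟩
      · exact h
      · exact absurd h hx
      · exact absurd h hy
      · rw [(Sym2.mem_and_mem_iff hne).1 h] at he
        exact he
    · intro h
      have hx : x ≠ n + 1 := by
        have := (B.2.mem_left h).2
        omega
      have hy : y ≠ n + 1 := by
        have := (B.2.mem_left h.symm).2
        omega
      refine ⟨h.ne, hx, hy, ?_⟩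
      by_cases hxy : s(x, y) = e
      · exact Or.inr ((Sym2.mem_and_mem_iff h.ne).2 hxy.symm)
      · exact Or.inl ⟨h.ne, Or.inl ⟨hx, hy, h, hxy⟩⟩
  · exact Sym2.ext fun y => (mem_lastEdge _).trans (hlast y)

open Classical in
/-- The cycles on `[n + 1]` that arise from `B` by inserting the node `n + 1`. -/
noncomputable def fiber {n : ℕ} (hn : 3 ≤ n) (B : CycleOn n) : Finset (CycleOn (n + 1)) :=
  Finset.univ.filter fun C => red hn C = B

theorem mem_fiber {n : ℕ} {hn : 3 ≤ n} {B : CycleOn n} {C : CycleOn (n + 1)} :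
    C ∈ fiber hn B ↔ red hn C = B := by
  simp [fiber]

open Classical in
theorem card_fiber_filter_mem_lastEdge {n : ℕ} (hn : 3 ≤ n) (B : CycleOn n) {x : ℕ}
    (hx : x ∈ Set.Icc 1 n) : ((fiber hn B).filter fun C => x ∈ lastEdge C).card = 2 := by
  obtain ⟨a, b, hab, h⟩ := B.2.exists_neighbors hx
  obtain ⟨C, hC, hC'⟩ := exists_red_eq_lastEdge_eq hn B (e := s(x, a)) ((h a).2 (Or.inl rfl))
  obtain ⟨D, hD, hD'⟩ := exists_red_eq_lastEdge_eq hn B (e := s(x, b)) ((h b).2 (Or.inr rfl))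
  rw [Finset.card_eq_two]
  refine ⟨C, D, fun hCD => ?_, ?_⟩
  · rw [hCD, hD', Sym2.congr_right] at hC'
    exact hab hC'.symm
  · ext E
    rw [Finset.mem_filter, mem_fiber, Finset.mem_insert, Finset.mem_singleton]
    constructor
    · rintro ⟨hE, hxE⟩
      obtain ⟨y, hy⟩ := Sym2.mem_iff_exists.1 hxE
      have hmem := lastEdge_mem_red hn E
      rw [hE, hy, SimpleGraph.mem_edgeSet, h] at hmem
      rcases hmem with rfl | rfl
      · exact Or.inl (eq_of_red_eq_of_lastEdge_eq hn (hE.trans hC.symm) (hy.trans hC'.symm))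
      · exact Or.inr (eq_of_red_eq_of_lastEdge_eq hn (hE.trans hD.symm) (hy.trans hD'.symm))
    · rintro (rfl | rfl)
      · exact ⟨hC, hC' ▸ Sym2.mem_mk_left _ _⟩
      · exact ⟨hD, hD' ▸ Sym2.mem_mk_left _ _⟩

/-- A cycle on `[n]` has `n` edges, so there are `n` ways of inserting the node `n + 1`. -/
theorem card_fiber {n : ℕ} (hn : 3 ≤ n) (B : CycleOn n) : (fiber hn B).card = n := by
  classical
  -- Count the pairs `(x, C)` with `x` an end of the edge into which `n + 1` is inserted.
  have h := Finset.sum_card_bipartiteAbove_eq_sum_card_bipartiteBelow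
    (s := Finset.Icc 1 n) (t := fiber hn B) (fun x C => x ∈ lastEdge C)
  rw [Finset.sum_congr rfl (g := fun _ => 2), Finset.sum_congr (s₁ := fiber hn B) rfl
    (g := fun _ => 2)] at h
  · simp at h
    omega
  · intro C hC
    obtain ⟨a, b, hab, hl⟩ := exists_lastEdge_eq C
    have hmem := lastEdge_mem_red hn C
    rw [Finset.bipartiteBelow, Finset.card_eq_two]
    refine ⟨a, b, hab, ?_⟩
    ext x
    simp only [Finset.mem_filter, Finset.mem_insert, Finset.mem_singleton, Finset.mem_Icc]
    rw [hl, Sym2.mem_iff]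
    refine ⟨And.right, fun hx => ⟨?_, hx⟩⟩
    exact mem_Icc_of_mem_edge _ hmem (by rw [hl, Sym2.mem_iff]; exact hx)
  · intro x hx
    exact card_fiber_filter_mem_lastEdge hn B (Finset.mem_Icc.1 hx)

instance : Subsingleton (CycleOn 3) := ⟨fun A B => Subtype.ext (by
  ext x y
  rw [A.2.adj_iff_of_three, B.2.adj_iff_of_three])⟩

/-! ### Anchors -/

theorem nu_red {n : ℕ} (hn : 3 ≤ n) (A : CycleOn (n + 1)) {k : ℕ} (hk : k ≤ n) :
    nu (red hn A) k = nu A k := by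
  have : ¬ n + 1 ≤ k := by omega
  simp only [nu, stage, this, if_false, red]

theorem nu_last {n : ℕ} (A : CycleOn n) : nu A n = (lastEdge A : Set ℕ) := by
  have h := A.three_le
  ext y
  rw [SetLike.mem_coe, mem_lastEdge]
  obtain ⟨n, rfl⟩ : ∃ k, n = k + 1 := ⟨n - 1, by omega⟩
  simp [nu, stage]

/-- `y` is an anchor, in the evolution of `Q`, of the pair `e` of nodes: either `y` is inserted
into `e`, or `y` is the larger end of `e` and is inserted into an edge disjoint from `e`. If `m` is a
vertex of the pedigree graph inserted into the edge `e` by one cycle, and `y < m` is a vertex that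
is an anchor of `e` in the other cycle, then `m` and `y` are adjacent. -/
def IsAnchor {n : ℕ} (Q : CycleOn n) (e : Sym2 ℕ) (y : ℕ) : Prop :=
  nu Q y = (e : Set ℕ) ∨ (IsGreatest (e : Set ℕ) y ∧ nu Q y ∩ (e : Set ℕ) = ∅)

theorem isAnchor_red {n : ℕ} (hn : 3 ≤ n) (Q : CycleOn (n + 1)) (e : Sym2 ℕ) {y : ℕ}
    (hy : y ≤ n) : IsAnchor (red hn Q) e y ↔ IsAnchor Q e y := by
  simp only [IsAnchor, nu_red hn Q hy]

theorem nu_subset {n : ℕ} (Q : CycleOn n) {y : ℕ} (h3 : 3 ≤ y) (hy : y ≤ n) :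
    nu Q y ⊆ Set.Icc 1 n := by
  have hn := Q.three_le
  induction n, hn using Nat.le_induction with
  | base =>
    obtain rfl : y = 3 := by omega
    rw [nu_last]
    intro x hx
    exact Q.2.mem_left ((mem_lastEdge Q).1 hx).symm
  | succ n hn ih =>
    by_cases h : y = n + 1
    · subst h
      rw [nu_last]
      intro x hx
      exact Q.2.mem_left ((mem_lastEdge Q).1 hx).symm
    · rw [← nu_red hn Q (by omega)]
      exact (ih (red hn Q) (by omega)).trans (Set.Icc_subset_Icc_right (by omega))

/-- A pair of nodes that is not an edge of the cycle has an anchor: either it never was an edge,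
or some node was inserted into it. -/
theorem exists_isAnchor {n : ℕ} (Q : CycleOn n) {e : Sym2 ℕ} (hd : ¬ e.IsDiag)
    (he : ∀ x ∈ e, x ∈ Set.Icc 1 n) (hQ : e ∉ Q.1.edgeSet) :
    ∃ y, 4 ≤ y ∧ y ≤ n ∧ IsAnchor Q e y := by
  have hn := Q.three_le
  induction n, hn using Nat.le_induction with
  | base =>
    exfalso
    induction e with
    | _ a b =>
    rw [SimpleGraph.mem_edgeSet, Q.2.adj_iff_of_three] at hQ
    exact hQ ⟨fun h => hd (Sym2.mk_isDiag_iff.2 h), he a (Sym2.mem_mk_left a b),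
      he b (Sym2.mem_mk_right a b)⟩
  | succ n hn ih =>
    by_cases hlast : n + 1 ∈ e
    · refine ⟨n + 1, by omega, le_rfl, Or.inr ⟨⟨hlast, fun x hx => (he x hx).2⟩, ?_⟩⟩
      obtain ⟨x, rfl⟩ := Sym2.mem_iff_exists.1 hlast
      rw [mk_last_mem_edgeSet] at hQ
      rw [nu_last, Set.eq_empty_iff_forall_notMem]
      rintro z ⟨hz, hz'⟩
      rw [SetLike.mem_coe] at hz hz'
      rcases Sym2.mem_iff.1 hz' with rfl | rfl
      · exact ((mem_lastEdge Q).1 hz).ne rfl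
      · exact hQ hz
    · by_cases hred : e ∈ (red hn Q).1.edgeSet
      · refine ⟨n + 1, by omega, le_rfl, Or.inl ?_⟩
        rw [mem_edgeSet_iff_red hn Q hlast, not_and_not_right] at hQ
        rw [nu_last, hQ hred]
      · have he' : ∀ x ∈ e, x ∈ Set.Icc 1 n := by
          intro x hx
          have h1 := he x hx
          have h2 : x ≠ n + 1 := fun h => hlast (h ▸ hx)
          simp only [Set.mem_Icc] at h1 ⊢
          omega
        obtain ⟨y, h4, hy, h⟩ := ih (red hn Q) he' hred
        exact ⟨y, h4, by omega, (isAnchor_red hn Q e hy).1 h⟩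

/-- A pair of nodes with an anchor is never an edge again. The bound `4 ≤ y` excludes `e = {1, 2}`
with `y = 3`, where the pair of the neighbours of `y` remains an edge. -/
theorem IsAnchor.notMem_edgeSet {n : ℕ} {Q : CycleOn n} {e : Sym2 ℕ} {y : ℕ}
    (h : IsAnchor Q e y) (h4 : 4 ≤ y) (hy : y ≤ n) : e ∉ Q.1.edgeSet := by
  have hn := Q.three_le
  induction n, hn using Nat.le_induction with
  | base => omega
  | succ n hn ih =>
    by_cases hyn : y = n + 1
    · subst hyn
      rw [IsAnchor, nu_last] at h
      rcases h with h | ⟨hg, h⟩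
      · rw [← SetLike.coe_injective h]
        exact lastEdge_notMem_edgeSet hn Q
      · obtain ⟨x, rfl⟩ := Sym2.mem_iff_exists.1 hg.1
        rw [mk_last_mem_edgeSet]
        intro hx
        exact Set.eq_empty_iff_forall_notMem.1 h x ⟨hx, Sym2.mem_mk_right _ _⟩
    · have hy' : y ≤ n := by omega
      have hred := (isAnchor_red hn Q e hy').2 h
      have hlast : n + 1 ∉ e := by
        intro hmem
        rcases hred with h' | ⟨h', -⟩
        · have := nu_subset (red hn Q) (by omega) hy' (h'.symm ▸ hmem : n + 1 ∈ _)
          have := this.2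
          omega
        · have := h'.2 hmem
          omega
      rw [mem_edgeSet_iff_red hn Q hlast, not_and]
      exact fun h' => absurd h' (ih hred hy')

/-! ### The pedigree graph under insertion of a node -/

theorem pedigreeVertices_comm {n : ℕ} (A B : CycleOn n) :
    pedigreeVertices A B = pedigreeVertices B A := by
  ext k
  exact and_congr_right fun _ => ne_comm

instance {n : ℕ} (A B : CycleOn n) : Finite (pedigreeVertices A B) :=
  ((Set.finite_Icc 1 n).subset fun _ h => h.1).to_subtype

theorem mem_pedigreeVertices_red {n : ℕ} (hn : 3 ≤ n) (A C : CycleOn (n + 1)) {k : ℕ} :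
    k ∈ pedigreeVertices (red hn A) (red hn C) ↔ k ∈ pedigreeVertices A C ∧ k ≤ n := by
  constructor
  · rintro ⟨hk, h⟩
    rw [nu_red hn A hk.2, nu_red hn C hk.2] at h
    exact ⟨⟨⟨hk.1, hk.2.trans (by omega)⟩, h⟩, hk.2⟩
  · rintro ⟨⟨hk, h⟩, hkn⟩
    refine ⟨⟨hk.1, hkn⟩, ?_⟩
    rwa [nu_red hn A hkn, nu_red hn C hkn]

theorem last_mem_pedigreeVertices {n : ℕ} (A B : CycleOn n) :
    n ∈ pedigreeVertices A B ↔ lastEdge A ≠ lastEdge B := by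
  have := A.three_le
  rw [pedigreeVertices, Set.mem_ofPred_eq, nu_last, nu_last, ne_eq, SetLike.coe_set_eq]
  exact and_iff_right ⟨by omega, le_rfl⟩

theorem lastEdge_ne_of_mem {n : ℕ} {A B : CycleOn n} {x : ℕ} (hx : x ∈ pedigreeVertices A B)
    (h : x = n) : lastEdge A ≠ lastEdge B := by
  subst h
  exact (last_mem_pedigreeVertices A B).1 hx

/-- The pedigree graph has no vertices only for equal cycles. -/
theorem eq_of_pedigreeVertices_eq_empty {n : ℕ} {A B : CycleOn n}
    (h : pedigreeVertices A B = ∅) : A = B := by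
  have hn := A.three_le
  induction n, hn using Nat.le_induction with
  | base => exact Subsingleton.elim A B
  | succ n hn ih =>
    refine eq_of_red_eq_of_lastEdge_eq hn (ih (Set.eq_empty_iff_forall_notMem.2 fun k hk => ?_)) ?_
    · exact Set.eq_empty_iff_forall_notMem.1 h k ((mem_pedigreeVertices_red hn A B).1 hk).1
    · by_contra hne
      exact Set.eq_empty_iff_forall_notMem.1 h _ ((last_mem_pedigreeVertices A B).2 hne)

theorem IsAnchor.mem_pedigreeVertices {n : ℕ} {P Q : CycleOn n} {e : Sym2 ℕ} {y : ℕ}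
    (h : IsAnchor Q e y) (h4 : 4 ≤ y) (hy : y ≤ n) (he : e ∈ P.1.edgeSet) :
    y ∈ pedigreeVertices P Q := by
  refine ⟨⟨by omega, hy⟩, fun hnu => ?_⟩
  have h' : IsAnchor P e y := by
    rw [IsAnchor, hnu]
    exact h
  exact h'.notMem_edgeSet h4 hy he

theorem pedigreeGraph_adj_of_isAnchor {n : ℕ} {A B : CycleOn n} {x y : pedigreeVertices A B}
    (hlt : y.1 < x.1) {e : Sym2 ℕ}
    (h : (nu A x = (e : Set ℕ) ∧ IsAnchor B e y) ∨ (nu B x = (e : Set ℕ) ∧ IsAnchor A e y)) :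
    (pedigreeGraph A B).Adj x y := by
  refine (SimpleGraph.fromRel_adj _ _ _).2 ⟨fun h => hlt.ne' (congrArg Subtype.val h), Or.inl ?_⟩
  rcases h with ⟨hx, h | ⟨hg, h⟩⟩ | ⟨hx, h | ⟨hg, h⟩⟩
  · exact Or.inl ⟨hlt, hx.trans h.symm⟩
  · exact Or.inr (Or.inr (Or.inl ⟨hlt, hx.symm ▸ hg, hx.symm ▸ h⟩))
  · exact Or.inr (Or.inl ⟨hlt, hx.trans h.symm⟩)
  · exact Or.inr (Or.inr (Or.inr ⟨hlt, hx.symm ▸ hg, hx.symm ▸ h⟩))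

/-- The inclusion of the pedigree graph of the stages on `[n]` into that of the cycles on
`[n + 1]`. -/
def redHom {n : ℕ} (hn : 3 ≤ n) (A C : CycleOn (n + 1)) :
    pedigreeGraph (red hn A) (red hn C) →g pedigreeGraph A C where
  toFun x := ⟨x.1, ((mem_pedigreeVertices_red hn A C).1 x.2).1⟩
  map_rel' := by
    rintro ⟨x, hx⟩ ⟨y, hy⟩ h
    rw [pedigreeGraph, SimpleGraph.fromRel_adj] at h ⊢
    simp only [IsType1, IsType2, nu_red hn _ hx.1.2, nu_red hn _ hy.1.2, ne_eq,
      Subtype.mk.injEq] at h ⊢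
    exact h

theorem eq_redHom_or_eq_last {n : ℕ} (hn : 3 ≤ n) (A C : CycleOn (n + 1))
    (x : pedigreeVertices A C) : (∃ y, x = redHom hn A C y) ∨ x.1 = n + 1 := by
  by_cases h : x.1 = n + 1
  · exact Or.inr h
  · have := x.2.1.2
    exact Or.inl ⟨⟨x.1, (mem_pedigreeVertices_red hn A C).2 ⟨x.2, by omega⟩⟩, rfl⟩

theorem adj_last_of_isAnchor {n : ℕ} (hn : 3 ≤ n) (A C : CycleOn (n + 1))
    {x : pedigreeVertices A C} (hx : x.1 = n + 1)
    {y : pedigreeVertices (red hn A) (red hn C)}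
    (h : IsAnchor (red hn C) (lastEdge A) y ∨ IsAnchor (red hn A) (lastEdge C) y) :
    (pedigreeGraph A C).Adj x (redHom hn A C y) := by
  have hy : y.1 ≤ n := y.2.1.2
  have hlt : (redHom hn A C y).1 < x.1 := by
    change y.1 < x.1
    omega
  rcases h with h | h
  · refine pedigreeGraph_adj_of_isAnchor hlt (e := lastEdge A) (Or.inl ⟨?_, ?_⟩)
    · rw [hx, nu_last]
    · exact (isAnchor_red hn C _ hy).1 h
  · refine pedigreeGraph_adj_of_isAnchor hlt (e := lastEdge C) (Or.inr ⟨?_, ?_⟩)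
    · rw [hx, nu_last]
    · exact (isAnchor_red hn A _ hy).1 h

theorem exists_isAnchor_of_mem_edgeSet {n : ℕ} {P Q : CycleOn n} {e : Sym2 ℕ}
    (hP : e ∈ P.1.edgeSet) (hQ : e ∉ Q.1.edgeSet) :
    ∃ y ∈ pedigreeVertices P Q, 4 ≤ y ∧ IsAnchor Q e y := by
  obtain ⟨y, h4, hy, h⟩ := exists_isAnchor Q (SimpleGraph.not_isDiag_of_mem_edgeSet _ hP)
    (fun x hx => mem_Icc_of_mem_edge P hP hx) hQ
  exact ⟨y, h.mem_pedigreeVertices h4 hy hP, h4, h⟩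

theorem exists_adj_last_left {n : ℕ} (hn : 3 ≤ n) (A C : CycleOn (n + 1))
    {x : pedigreeVertices A C} (hx : x.1 = n + 1) (h : lastEdge A ∉ (red hn C).1.edgeSet) :
    ∃ y, (pedigreeGraph A C).Adj x (redHom hn A C y) := by
  obtain ⟨y, hy, -, hy'⟩ := exists_isAnchor_of_mem_edgeSet (lastEdge_mem_red hn A) h
  exact ⟨⟨y, hy⟩, adj_last_of_isAnchor hn A C hx (Or.inl hy')⟩

theorem exists_adj_last_right {n : ℕ} (hn : 3 ≤ n) (A C : CycleOn (n + 1))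
    {x : pedigreeVertices A C} (hx : x.1 = n + 1) (h : lastEdge C ∉ (red hn A).1.edgeSet) :
    ∃ y, (pedigreeGraph A C).Adj x (redHom hn A C y) := by
  obtain ⟨y, hy, -, hy'⟩ := exists_isAnchor_of_mem_edgeSet (lastEdge_mem_red hn C) h
  rw [pedigreeVertices_comm] at hy
  exact ⟨⟨y, hy⟩, adj_last_of_isAnchor hn A C hx (Or.inr hy')⟩

/-- Every connected component of the pedigree graph contains an anchor of an edge of `B`. The
component may lose such an edge only to the insertion of a node by `B`, and this node then anchors
an edge of `B` incident with it. -/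
theorem exists_reachable_isAnchor {n : ℕ} (A B : CycleOn n) (x : pedigreeVertices A B) :
    ∃ y, (pedigreeGraph A B).Reachable x y ∧
      ∃ e ∈ B.1.edgeSet, 4 ≤ y.1 ∧ IsAnchor A e y := by
  have hn := A.three_le
  induction n, hn using Nat.le_induction with
  | base =>
    obtain ⟨x, hx⟩ := x
    exact absurd (congrArg (nu · x) (Subsingleton.elim A B)) hx.2
  | succ n hn ih =>
    -- The last node anchors its edge in `B` to any neighbour that is not a neighbour in `A`.
    have key : ∀ z : pedigreeVertices A B, z.1 = n + 1 →
        ∃ e ∈ B.1.edgeSet, 4 ≤ z.1 ∧ IsAnchor A e z := by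
      intro z hz
      have hne := lastEdge_ne_of_mem z.2 hz
      obtain ⟨a, haB, haA⟩ : ∃ a, a ∈ lastEdge B ∧ a ∉ lastEdge A := by
        by_contra! hcon
        obtain ⟨a, b, hab, hl⟩ := exists_lastEdge_eq B
        rw [hl] at hcon hne
        exact hne ((Sym2.mem_and_mem_iff hab).1
          ⟨hcon a (Sym2.mem_mk_left a b), hcon b (Sym2.mem_mk_right a b)⟩)
      have he := (mk_last_mem_edgeSet B).2 haB
      refine ⟨s(n + 1, a), he, by omega, Or.inr ⟨⟨?_, ?_⟩, ?_⟩⟩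
      · rw [hz]
        exact Sym2.mem_mk_left _ _
      · intro w hw
        rw [hz]
        exact (mem_Icc_of_mem_edge B he hw).2
      · rw [hz, nu_last, Set.eq_empty_iff_forall_notMem]
        rintro w ⟨hw, hw'⟩
        rw [SetLike.mem_coe] at hw hw'
        rcases Sym2.mem_iff.1 hw' with rfl | rfl
        · exact ((mem_lastEdge A).1 hw).ne rfl
        · exact haA hw
    rcases eq_redHom_or_eq_last hn A B x with ⟨x', rfl⟩ | hx
    · obtain ⟨y', hreach, e, he, h4, hanchor⟩ := ih (red hn A) (red hn B) x'
      have hy' : y'.1 ≤ n := y'.2.1.2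
      have hreach' := hreach.map (redHom hn A B)
      by_cases hel : e = lastEdge B
      · subst hel
        have hA := hanchor.notMem_edgeSet h4 hy'
        have hlast : n + 1 ∈ pedigreeVertices A B := by
          rw [last_mem_pedigreeVertices]
          intro h
          exact hA (h ▸ lastEdge_mem_red hn A)
        refine ⟨⟨n + 1, hlast⟩, hreach'.trans ?_, key _ rfl⟩
        exact (adj_last_of_isAnchor hn A B rfl (Or.inr hanchor)).symm.reachable
      · refine ⟨_, hreach', e, ?_, h4, (isAnchor_red hn A e hy').1 hanchor⟩
        rw [mem_edgeSet_iff_red hn B (notMem_of_mem_edge _ he)]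
        exact ⟨he, hel⟩
    · exact ⟨x, SimpleGraph.Reachable.rfl, key x hx⟩

/-! ### The number of connected components -/

theorem card_connectedComponent_le_of_hom {α β : Type*} [Finite α] {G : SimpleGraph α}
    {H : SimpleGraph β} (f : G →g H) (h : ∀ b, ∃ a, H.Reachable b (f a)) :
    Nat.card H.ConnectedComponent ≤ Nat.card G.ConnectedComponent := by
  refine Nat.card_le_card_of_surjective (SimpleGraph.ConnectedComponent.map f) ?_
  intro c
  induction c using SimpleGraph.ConnectedComponent.ind with
  | _ b =>
  obtain ⟨a, ha⟩ := h b
  exact ⟨G.connectedComponentMk a, (SimpleGraph.ConnectedComponent.sound ha).symm⟩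

theorem card_connectedComponent_lt_of_hom {α β : Type*} [Finite α] {G : SimpleGraph α}
    {H : SimpleGraph β} (f : G →g H) (h : ∀ b, ∃ a, H.Reachable b (f a)) {a₁ a₂ : α}
    (hG : ¬ G.Reachable a₁ a₂) (hH : H.Reachable (f a₁) (f a₂)) :
    Nat.card H.ConnectedComponent < Nat.card G.ConnectedComponent := by
  have hsurj : Function.Surjective (SimpleGraph.ConnectedComponent.map f) := by
    intro c
    induction c using SimpleGraph.ConnectedComponent.ind with
    | _ b =>
    obtain ⟨a, ha⟩ := h b
    exact ⟨G.connectedComponentMk a, (SimpleGraph.ConnectedComponent.sound ha).symm⟩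
  refine (Nat.card_le_card_of_surjective _ hsurj).lt_of_ne fun heq => hG ?_
  have hbij := hsurj.bijective_of_nat_card_le heq.ge
  exact SimpleGraph.ConnectedComponent.exact (hbij.1 (SimpleGraph.ConnectedComponent.sound hH))

theorem card_connectedComponent_le_add_one {α β : Type*} [Finite α] {G : SimpleGraph α}
    {H : SimpleGraph β} (f : G →g H) {b₀ : β} (h : ∀ b, (∃ a, b = f a) ∨ b = b₀) :
    Nat.card H.ConnectedComponent ≤ Nat.card G.ConnectedComponent + 1 := by
  rw [← Finite.card_option]
  refine Nat.card_le_card_of_surjective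
    (fun c => c.elim (H.connectedComponentMk b₀) (SimpleGraph.ConnectedComponent.map f)) ?_
  intro c
  induction c using SimpleGraph.ConnectedComponent.ind with
  | _ b =>
  rcases h b with ⟨a, rfl⟩ | rfl
  · exact ⟨some (G.connectedComponentMk a), rfl⟩
  · exact ⟨none, rfl⟩

/-- The number of connected components of the pedigree graph. -/
noncomputable def numComp {n : ℕ} (A B : CycleOn n) : ℕ :=
  Nat.card (pedigreeGraph A B).ConnectedComponent

/-- The insertion of the last node creates a new connected component of the pedigree graph: both
cycles insert it into common edges, but into different ones. -/
def IsNew {n : ℕ} (hn : 3 ≤ n) (A C : CycleOn (n + 1)) : Prop :=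
  lastEdge A ∈ (red hn C).1.edgeSet ∧ lastEdge C ∈ (red hn A).1.edgeSet ∧ lastEdge A ≠ lastEdge C

theorem numComp_le_add_one {n : ℕ} (hn : 3 ≤ n) (A C : CycleOn (n + 1)) :
    numComp A C ≤ numComp (red hn A) (red hn C) + 1 := by
  by_cases h : ∃ b : pedigreeVertices A C, b.1 = n + 1
  · obtain ⟨b, hb⟩ := h
    refine card_connectedComponent_le_add_one (redHom hn A C) (b₀ := b) fun x => ?_
    exact (eq_redHom_or_eq_last hn A C x).imp_right fun h => Subtype.ext (h.trans hb.symm)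
  · refine (card_connectedComponent_le_of_hom (redHom hn A C) fun x => ?_).trans (Nat.le_succ _)
    rcases eq_redHom_or_eq_last hn A C x with ⟨y, rfl⟩ | hx
    · exact ⟨y, SimpleGraph.Reachable.rfl⟩
    · exact absurd ⟨x, hx⟩ h

theorem exists_reachable_redHom {n : ℕ} (hn : 3 ≤ n) {A C : CycleOn (n + 1)}
    (h : ¬ IsNew hn A C) (x : pedigreeVertices A C) :
    ∃ y, (pedigreeGraph A C).Reachable x (redHom hn A C y) := by
  rcases eq_redHom_or_eq_last hn A C x with ⟨y, rfl⟩ | hx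
  · exact ⟨y, SimpleGraph.Reachable.rfl⟩
  · have hne := lastEdge_ne_of_mem x.2 hx
    by_cases hA : lastEdge A ∈ (red hn C).1.edgeSet
    · have hC : lastEdge C ∉ (red hn A).1.edgeSet := fun hC => h ⟨hA, hC, hne⟩
      obtain ⟨y, hy⟩ := exists_adj_last_right hn A C hx hC
      exact ⟨y, hy.reachable⟩
    · obtain ⟨y, hy⟩ := exists_adj_last_left hn A C hx hA
      exact ⟨y, hy.reachable⟩

theorem numComp_le_of_not_isNew {n : ℕ} (hn : 3 ≤ n) {A C : CycleOn (n + 1)}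
    (h : ¬ IsNew hn A C) : numComp A C ≤ numComp (red hn A) (red hn C) :=
  card_connectedComponent_le_of_hom (redHom hn A C) (exists_reachable_redHom hn h)

/-- If there are at least two connected components and `A` inserts the node `n + 1` into an edge
not shared with `B`, then some insertion of `n + 1` into `B` merges two components. -/
theorem exists_numComp_lt {n : ℕ} (hn : 3 ≤ n) (A : CycleOn (n + 1)) (B : CycleOn n)
    (hA : lastEdge A ∉ B.1.edgeSet) (h2 : 2 ≤ numComp (red hn A) B) :
    ∃ C ∈ fiber hn B, numComp A C + 1 ≤ numComp (red hn A) B := by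
  obtain ⟨y, hy, -, hyA⟩ := exists_isAnchor_of_mem_edgeSet (lastEdge_mem_red hn A) hA
  obtain ⟨z, hz⟩ : ∃ z, ¬ (pedigreeGraph (red hn A) B).Reachable z ⟨y, hy⟩ := by
    by_contra! hcon
    have : Subsingleton (pedigreeGraph (red hn A) B).ConnectedComponent := by
      refine SimpleGraph.Preconnected.subsingleton_connectedComponent fun u v => ?_
      exact (hcon u).trans (hcon v).symm
    have := Finite.card_le_one_iff_subsingleton.2 this
    rw [numComp] at h2
    omega
  obtain ⟨w, hw, e, he, h4, hanchor⟩ := exists_reachable_isAnchor (red hn A) B z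
  obtain ⟨C, rfl, rfl⟩ := exists_red_eq_lastEdge_eq hn B he
  have hC := hanchor.notMem_edgeSet h4 w.2.1.2
  have hlast : n + 1 ∈ pedigreeVertices A C := by
    rw [last_mem_pedigreeVertices]
    intro h
    exact hC (h ▸ lastEdge_mem_red hn A)
  refine ⟨C, mem_fiber.2 rfl, ?_⟩
  refine card_connectedComponent_lt_of_hom (redHom hn A C)
    (exists_reachable_redHom hn fun h => hA h.1) (a₁ := w) (a₂ := ⟨y, hy⟩)
    (fun h => hz (hw.trans h)) ?_
  exact (adj_last_of_isAnchor hn A C (x := ⟨n + 1, hlast⟩) rfl (Or.inr hanchor)).symm.reachable.trans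
    (adj_last_of_isAnchor hn A C rfl (Or.inl hyA)).reachable

/-! ### Averages over the cycles on `[n]` -/

/-- The expectation of `f B` for a uniformly random cycle `B` on `[n]`; it is `0` if there are no
such cycles. -/
noncomputable def avg {n : ℕ} (f : CycleOn n → ℝ) : ℝ :=
  (∑ B, f B) / Fintype.card (CycleOn n)

open Classical in
/-- The probability of the event `p` for a uniformly random cycle on `[n]`. -/
noncomputable def prob {n : ℕ} (p : CycleOn n → Prop) : ℝ := avg fun B => if p B then 1 else 0

theorem prob_eq {n : ℕ} (p : CycleOn n → Prop) [DecidablePred p] :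
    prob p = avg fun B => if p B then 1 else 0 := by
  rw [prob]
  congr! 3

theorem avg_mono {n : ℕ} {f g : CycleOn n → ℝ} (h : ∀ B, f B ≤ g B) : avg f ≤ avg g :=
  div_le_div_of_nonneg_right (Finset.sum_le_sum fun B _ => h B) (Nat.cast_nonneg _)

theorem avg_nonneg {n : ℕ} {f : CycleOn n → ℝ} (h : ∀ B, 0 ≤ f B) : 0 ≤ avg f :=
  div_nonneg (Finset.sum_nonneg fun B _ => h B) (Nat.cast_nonneg _)

theorem avg_add {n : ℕ} (f g : CycleOn n → ℝ) : avg (fun B => f B + g B) = avg f + avg g := by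
  rw [avg, Finset.sum_add_distrib, add_div]
  rfl

theorem avg_sub {n : ℕ} (f g : CycleOn n → ℝ) : avg (fun B => f B - g B) = avg f - avg g := by
  rw [avg, Finset.sum_sub_distrib, sub_div]
  rfl

theorem avg_mul {n : ℕ} (c : ℝ) (f : CycleOn n → ℝ) : avg (fun B => c * f B) = c * avg f := by
  rw [avg, ← Finset.mul_sum, mul_div_assoc]
  rfl

theorem avg_sum {n : ℕ} {ι : Type*} (s : Finset ι) (f : ι → CycleOn n → ℝ) :
    avg (fun B => ∑ i ∈ s, f i B) = ∑ i ∈ s, avg (f i) := by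
  rw [avg, Finset.sum_comm, Finset.sum_div]
  rfl

theorem avg_le_of_le {n : ℕ} {f : CycleOn n → ℝ} {c : ℝ} (hc : 0 ≤ c) (h : ∀ B, f B ≤ c) :
    avg f ≤ c := by
  refine div_le_of_le_mul₀ (Nat.cast_nonneg _) hc ?_
  refine (Finset.sum_le_sum fun B _ => h B).trans_eq ?_
  rw [Finset.sum_const, nsmul_eq_mul, mul_comm]
  rfl

theorem prob_nonneg {n : ℕ} (p : CycleOn n → Prop) : 0 ≤ prob p :=
  avg_nonneg fun B => by split_ifs <;> norm_num

theorem prob_le_one {n : ℕ} (p : CycleOn n → Prop) : prob p ≤ 1 :=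
  avg_le_of_le zero_le_one fun B => by split_ifs <;> norm_num

theorem sum_eq_sum_fiber {n : ℕ} (hn : 3 ≤ n) {M : Type*} [AddCommMonoid M]
    (f : CycleOn (n + 1) → M) : ∑ C, f C = ∑ B, ∑ C ∈ fiber hn B, f C := by
  classical
  rw [← Finset.sum_fiberwise Finset.univ (red hn) f]
  refine Finset.sum_congr rfl fun B _ => Finset.sum_congr ?_ fun _ _ => rfl
  ext C
  simp [mem_fiber]

theorem card_cycleOn_succ {n : ℕ} (hn : 3 ≤ n) :
    Fintype.card (CycleOn (n + 1)) = n * Fintype.card (CycleOn n) := by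
  have := sum_eq_sum_fiber hn (fun _ => 1)
  simpa [card_fiber, mul_comm] using this

/-- The random cycle on `[n + 1]` arises from the random cycle on `[n]` by inserting the node
`n + 1` into a uniformly random edge. -/
theorem avg_succ_le {n : ℕ} (hn : 3 ≤ n) {f : CycleOn (n + 1) → ℝ} {g : CycleOn n → ℝ}
    (h : ∀ B, ∑ C ∈ fiber hn B, f C ≤ n * g B) : avg f ≤ avg g := by
  have hn' : (n : ℝ) ≠ 0 := by positivity
  have : avg g = (∑ B, n * g B) / Fintype.card (CycleOn (n + 1)) := by
    rw [card_cycleOn_succ hn, ← Finset.mul_sum, Nat.cast_mul, mul_div_mul_left _ _ hn']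
    rfl
  rw [this, avg, sum_eq_sum_fiber hn]
  exact div_le_div_of_nonneg_right (Finset.sum_le_sum fun B _ => h B) (Nat.cast_nonneg _)

theorem prob_succ_le {n : ℕ} (hn : 3 ≤ n) {p : CycleOn (n + 1) → Prop} [DecidablePred p]
    {g : CycleOn n → ℝ} (h : ∀ B, (((fiber hn B).filter p).card : ℝ) ≤ n * g B) :
    prob p ≤ avg g := by
  rw [prob_eq]
  exact avg_succ_le hn fun B => (Finset.sum_boole _ _).trans_le (h B)

theorem prob_succ_le_mul {n : ℕ} (hn : 3 ≤ n) {p : CycleOn (n + 1) → Prop} [DecidablePred p]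
    {q : CycleOn n → Prop} {k : ℝ} (h : ∀ B, q B → (((fiber hn B).filter p).card : ℝ) ≤ k)
    (hpq : ∀ C, p C → q (red hn C)) : prob p ≤ k / n * prob q := by
  classical
  have hn' : (n : ℝ) ≠ 0 := by positivity
  rw [prob_eq q, ← avg_mul]
  refine prob_succ_le hn fun B => ?_
  by_cases hB : q B
  · rw [if_pos hB, mul_one, mul_div_cancel₀ _ hn']
    exact h B hB
  · rw [if_neg hB, Finset.filter_false_of_mem]
    · simp
    · intro C hC hp
      rw [mem_fiber] at hC
      exact hB (hC ▸ hpq C hp)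

/-! ### Edges of a random cycle -/

theorem mem_red_of_mem_edgeSet {n : ℕ} (hn : 3 ≤ n) {C : CycleOn (n + 1)} {e : Sym2 ℕ}
    (he : n + 1 ∉ e) (h : e ∈ C.1.edgeSet) : e ∈ (red hn C).1.edgeSet :=
  ((mem_edgeSet_iff_red hn C he).1 h).1

open Classical in
theorem card_fiber_filter_mem_lastEdge_le {n : ℕ} (hn : 3 ≤ n) (B : CycleOn n) (x : ℕ) :
    ((fiber hn B).filter fun C => x ∈ lastEdge C).card ≤ 2 := by
  by_cases hx : x ∈ Set.Icc 1 n
  · exact (card_fiber_filter_mem_lastEdge hn B hx).le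
  · rw [Finset.filter_false_of_mem]
    · simp
    · intro C _ h
      exact hx (mem_Icc_of_mem_edge _ (lastEdge_mem_red hn C) h)

theorem prob_mem_edgeSet_le {n : ℕ} (hn : 3 ≤ n) (e : Sym2 ℕ) :
    prob (fun B : CycleOn n => e ∈ B.1.edgeSet) ≤ 2 / (n - 1) := by
  classical
  induction n, hn using Nat.le_induction with
  | base =>
    refine (prob_le_one _).trans ?_
    norm_num
  | succ n hn ih =>
    have hn3 : (3 : ℝ) ≤ n := by exact_mod_cast hn
    push_cast
    rw [add_sub_cancel_right]
    by_cases he : n + 1 ∈ e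
    · obtain ⟨x, rfl⟩ := Sym2.mem_iff_exists.1 he
      have := prob_succ_le_mul hn (p := fun C : CycleOn (n + 1) => s(n + 1, x) ∈ C.1.edgeSet)
        (q := fun _ => True) (k := 2) (fun B _ => ?_) (fun _ _ => trivial)
      · refine this.trans ?_
        exact mul_le_of_le_one_right (by positivity) (prob_le_one _)
      · simp only [mk_last_mem_edgeSet]
        exact_mod_cast card_fiber_filter_mem_lastEdge_le hn B x
    · have := prob_succ_le_mul hn (p := fun C : CycleOn (n + 1) => e ∈ C.1.edgeSet)
        (q := fun B => e ∈ B.1.edgeSet) (k := n - 1) (fun B hB => ?_)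
        (fun C hC => mem_red_of_mem_edgeSet hn he hC)
      · refine this.trans ((mul_le_mul_of_nonneg_left ih ?_).trans_eq ?_)
        · exact div_nonneg (by linarith) (by linarith)
        · have : (n : ℝ) - 1 ≠ 0 := by linarith
          field_simp
      · obtain ⟨C, hC, hCe⟩ := exists_red_eq_lastEdge_eq hn B hB
        have hsub : ((fiber hn B).filter fun C => e ∈ C.1.edgeSet) ⊆ (fiber hn B).erase C := by
          intro D hD
          rw [Finset.mem_filter] at hD
          refine Finset.mem_erase.2 ⟨?_, hD.1⟩
          rintro rfl
          exact lastEdge_notMem_edgeSet hn D (hCe.symm ▸ hD.2)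
        have := Finset.card_le_card hsub
        rw [Finset.card_erase_of_mem (mem_fiber.2 hC), card_fiber] at this
        have : ((((fiber hn B).filter fun C => e ∈ C.1.edgeSet).card + 1 : ℕ) : ℝ) ≤ n := by
          exact_mod_cast (by omega)
        push_cast at this
        linarith

theorem prob_mem_mem_edgeSet_le {n : ℕ} (hn : 3 ≤ n) {e f : Sym2 ℕ} (hef : e ≠ f) :
    prob (fun B : CycleOn n => e ∈ B.1.edgeSet ∧ f ∈ B.1.edgeSet) ≤
      4 / ((n - 1) * (n - 2)) := by
  classical
  induction n, hn using Nat.le_induction with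
  | base =>
    refine (prob_le_one _).trans ?_
    norm_num
  | succ n hn ih =>
    have hn3 : (3 : ℝ) ≤ n := by exact_mod_cast hn
    have hn0 : (n : ℝ) ≠ 0 := by linarith
    have hn1 : (n : ℝ) - 1 ≠ 0 := by linarith
    have hn2 : (n : ℝ) - 2 ≠ 0 := by linarith
    have hn21 : (n : ℝ) + 1 - 2 = n - 1 := by ring
    push_cast
    rw [add_sub_cancel_right, hn21]
    -- Exactly one of the two edges contains the last node.
    have mixed : ∀ e f : Sym2 ℕ, n + 1 ∉ e → n + 1 ∈ f →
        prob (fun C : CycleOn (n + 1) => e ∈ C.1.edgeSet ∧ f ∈ C.1.edgeSet) ≤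
          4 / (n * (n - 1)) := by
      intro e f he hf
      obtain ⟨x, rfl⟩ := Sym2.mem_iff_exists.1 hf
      have := prob_succ_le_mul hn
        (p := fun C : CycleOn (n + 1) => e ∈ C.1.edgeSet ∧ s(n + 1, x) ∈ C.1.edgeSet)
        (q := fun B => e ∈ B.1.edgeSet) (k := 2) (fun B _ => ?_)
        (fun C hC => mem_red_of_mem_edgeSet hn he hC.1)
      · refine this.trans
          ((mul_le_mul_of_nonneg_left (prob_mem_edgeSet_le hn e) (by positivity)).trans_eq ?_)
        field_simp
        norm_num
      · simp only [mk_last_mem_edgeSet]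
        refine le_trans ?_ (Nat.cast_le.2 (card_fiber_filter_mem_lastEdge_le hn B x))
        exact Nat.cast_le.2 (Finset.card_le_card
          (Finset.monotone_filter_right _ fun C _ hC => hC.2))
    by_cases he : n + 1 ∈ e <;> by_cases hf : n + 1 ∈ f
    · obtain ⟨x, rfl⟩ := Sym2.mem_iff_exists.1 he
      obtain ⟨y, rfl⟩ := Sym2.mem_iff_exists.1 hf
      have hxy : x ≠ y := fun h => hef (h ▸ rfl)
      have hlast : ∀ C : CycleOn (n + 1),
          s(n + 1, x) ∈ C.1.edgeSet ∧ s(n + 1, y) ∈ C.1.edgeSet → lastEdge C = s(x, y) := by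
        intro C hC
        rw [mk_last_mem_edgeSet, mk_last_mem_edgeSet] at hC
        exact (Sym2.mem_and_mem_iff hxy).1 hC
      have := prob_succ_le_mul hn
        (p := fun C : CycleOn (n + 1) => s(n + 1, x) ∈ C.1.edgeSet ∧ s(n + 1, y) ∈ C.1.edgeSet)
        (q := fun B => s(x, y) ∈ B.1.edgeSet) (k := 1) (fun B _ => ?_)
        (fun C hC => hlast C hC ▸ lastEdge_mem_red hn C)
      · refine this.trans ((mul_le_mul_of_nonneg_left (prob_mem_edgeSet_le hn s(x, y))
          (by positivity)).trans ?_)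
        rw [div_mul_div_comm, one_mul]
        exact div_le_div_of_nonneg_right (by norm_num) (mul_nonneg (by linarith) (by linarith))
      · have : ((fiber hn B).filter fun C : CycleOn (n + 1) =>
            s(n + 1, x) ∈ C.1.edgeSet ∧ s(n + 1, y) ∈ C.1.edgeSet).card ≤ 1 := by
          refine Finset.card_le_one.2 fun C hC D hD => ?_
          rw [Finset.mem_filter, mem_fiber] at hC hD
          exact eq_of_red_eq_of_lastEdge_eq hn (hC.1.trans hD.1.symm)
            ((hlast C hC.2).trans (hlast D hD.2).symm)
        exact_mod_cast this
    · simp only [and_comm (a := e ∈ _)]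
      exact mixed f e hf he
    · exact mixed e f he hf
    · have := prob_succ_le_mul hn
        (p := fun C : CycleOn (n + 1) => e ∈ C.1.edgeSet ∧ f ∈ C.1.edgeSet)
        (q := fun B => e ∈ B.1.edgeSet ∧ f ∈ B.1.edgeSet) (k := n - 2) (fun B hB => ?_)
        (fun C hC => ⟨mem_red_of_mem_edgeSet hn he hC.1, mem_red_of_mem_edgeSet hn hf hC.2⟩)
      · refine this.trans ((mul_le_mul_of_nonneg_left ih ?_).trans_eq ?_)
        · exact div_nonneg (by linarith) (by linarith)
        · field_simp
      · obtain ⟨C, hC, hCe⟩ := exists_red_eq_lastEdge_eq hn B hB.1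
        obtain ⟨D, hD, hDf⟩ := exists_red_eq_lastEdge_eq hn B hB.2
        have hCD : D ≠ C := fun h => hef (hCe.symm.trans (h ▸ hDf))
        have hsub : ((fiber hn B).filter fun C => e ∈ C.1.edgeSet ∧ f ∈ C.1.edgeSet) ⊆
            ((fiber hn B).erase C).erase D := by
          intro E hE
          rw [Finset.mem_filter] at hE
          refine Finset.mem_erase.2 ⟨?_, Finset.mem_erase.2 ⟨?_, hE.1⟩⟩
          · rintro rfl
            exact lastEdge_notMem_edgeSet hn E (hDf.symm ▸ hE.2.2)
          · rintro rfl
            exact lastEdge_notMem_edgeSet hn E (hCe.symm ▸ hE.2.1)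
        have := Finset.card_le_card hsub
        rw [Finset.card_erase_of_mem (Finset.mem_erase.2 ⟨hCD, mem_fiber.2 hD⟩),
          Finset.card_erase_of_mem (mem_fiber.2 hC), card_fiber] at this
        have : ((((fiber hn B).filter fun C => e ∈ C.1.edgeSet ∧ f ∈ C.1.edgeSet).card + 2 : ℕ) :
            ℝ) ≤ n := by
          exact_mod_cast (by omega)
        push_cast at this
        linarith

/-! ### The drift of the number of components -/

theorem prob_isNew_le {n : ℕ} (hn : 3 ≤ n) (A : CycleOn (n + 1)) :
    prob (IsNew hn A) ≤ 4 / ((n - 1) * (n - 2)) := by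
  classical
  have hn3 : (3 : ℝ) ≤ n := by exact_mod_cast hn
  set g : CycleOn n → ℝ := fun B => (1 / n : ℝ) * ∑ D ∈ (fiber hn (red hn A)).erase A,
    if lastEdge A ∈ B.1.edgeSet ∧ lastEdge D ∈ B.1.edgeSet then (1 : ℝ) else 0 with hg
  have h1 : prob (IsNew hn A) ≤ avg g := by
    refine prob_succ_le hn fun B => ?_
    rw [hg]
    dsimp only
    rw [← mul_assoc, mul_one_div_cancel (by linarith), one_mul, Finset.sum_boole, Nat.cast_le]
    have hinj : Set.InjOn lastEdge ((fiber hn B).filter (IsNew hn A) : Set (CycleOn (n + 1))) := by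
      intro C hC D hD h
      rw [Finset.mem_coe, Finset.mem_filter, mem_fiber] at hC hD
      exact eq_of_red_eq_of_lastEdge_eq hn (hC.1.trans hD.1.symm) h
    rw [← Finset.card_image_of_injOn hinj]
    refine (Finset.card_le_card ?_).trans (Finset.card_image_le (f := lastEdge))
    intro e he
    obtain ⟨C, hC, rfl⟩ := Finset.mem_image.1 he
    rw [Finset.mem_filter, mem_fiber] at hC
    obtain ⟨rfl, hA, hC, hne⟩ := hC
    obtain ⟨D, hD, hDC⟩ := exists_red_eq_lastEdge_eq hn (red hn A) hC
    refine Finset.mem_image.2 ⟨D, Finset.mem_filter.2 ⟨Finset.mem_erase.2 ⟨?_, mem_fiber.2 hD⟩,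
      hA, hDC ▸ lastEdge_mem_red hn C⟩, hDC⟩
    rintro rfl
    exact hne hDC
  have h2 : avg g ≤ (1 / n : ℝ) *
      ∑ D ∈ (fiber hn (red hn A)).erase A, 4 / (((n : ℝ) - 1) * (n - 2)) := by
    rw [hg, avg_mul, avg_sum]
    refine mul_le_mul_of_nonneg_left (Finset.sum_le_sum fun D hD => ?_) (by positivity)
    rw [Finset.mem_erase, mem_fiber] at hD
    rw [← prob_eq fun B : CycleOn n => lastEdge A ∈ B.1.edgeSet ∧ lastEdge D ∈ B.1.edgeSet]
    exact prob_mem_mem_edgeSet_le hn fun h =>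
      hD.1 (eq_of_red_eq_of_lastEdge_eq hn hD.2 h.symm)
  refine h1.trans (h2.trans ?_)
  rw [Finset.sum_const, Finset.card_erase_of_mem (mem_fiber.2 rfl), card_fiber, nsmul_eq_mul,
    ← mul_assoc]
  refine mul_le_of_le_one_left (div_nonneg (by norm_num)
    (mul_nonneg (by linarith) (by linarith))) ?_
  rw [one_div_mul_eq_div, div_le_one (by linarith), Nat.cast_le]
  exact Nat.sub_le n 1

theorem prob_two_le_numComp_succ_le {n : ℕ} (hn : 3 ≤ n) (A : CycleOn (n + 1)) :
    prob (fun C => 2 ≤ numComp A C) ≤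
      prob (fun B => 2 ≤ numComp (red hn A) B) + 4 / ((n - 1) * (n - 2)) := by
  classical
  rw [prob_eq]
  refine le_trans (b := avg fun C => (if 2 ≤ numComp (red hn A) (red hn C) then 1 else 0) +
    if IsNew hn A C then 1 else 0) (avg_mono fun C => ?_) ?_
  · by_cases h : IsNew hn A C
    · rw [if_pos h]
      split_ifs <;> norm_num
    · have := numComp_le_of_not_isNew hn h
      rw [if_neg h]
      by_cases h2 : 2 ≤ numComp A C
      · rw [if_pos h2, if_pos (h2.trans this), add_zero]
      · rw [if_neg h2]
        split_ifs <;> norm_num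
  · rw [avg_add, ← prob_eq, prob_eq fun B => 2 ≤ numComp (red hn A) B]
    refine add_le_add (avg_succ_le hn fun B => ?_) (prob_isNew_le hn A)
    rw [Finset.sum_congr rfl (g := fun _ => if 2 ≤ numComp (red hn A) B then (1 : ℝ) else 0),
      Finset.sum_const, card_fiber, nsmul_eq_mul]
    intro C hC
    simp only [mem_fiber.1 hC]

theorem avg_numComp_succ_le {n : ℕ} (hn : 3 ≤ n) (A : CycleOn (n + 1)) :
    avg (fun C => (numComp A C : ℝ)) ≤ avg (fun B => (numComp (red hn A) B : ℝ)) +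
      6 / ((n - 1) * (n - 2)) - prob (fun B => 2 ≤ numComp (red hn A) B) / n := by
  classical
  have hn3 : (3 : ℝ) ≤ n := by exact_mod_cast hn
  have hn0 : (n : ℝ) ≠ 0 := by linarith
  have hn1 : (n : ℝ) - 1 ≠ 0 := by linarith
  have hn2 : (n : ℝ) - 2 ≠ 0 := by linarith
  have h1 : avg (fun C => (numComp A C : ℝ) - if IsNew hn A C then 1 else 0) ≤
      avg (fun B => (numComp (red hn A) B : ℝ) - 1 / n *
        ((if 2 ≤ numComp (red hn A) B then 1 else 0) -
          if lastEdge A ∈ B.1.edgeSet then 1 else 0)) := by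
    refine avg_succ_le hn fun B => ?_
    rw [mul_sub, ← mul_assoc, mul_one_div_cancel hn0, one_mul]
    have hle : ∀ C ∈ fiber hn B,
        (numComp A C : ℝ) - (if IsNew hn A C then 1 else 0) ≤ numComp (red hn A) B := by
      intro C hC
      rw [mem_fiber] at hC
      subst hC
      split_ifs with h
      · have : (numComp A C : ℝ) ≤ numComp (red hn A) (red hn C) + 1 := by
          exact_mod_cast numComp_le_add_one hn A C
        linarith
      · have : (numComp A C : ℝ) ≤ numComp (red hn A) (red hn C) := by
          exact_mod_cast numComp_le_of_not_isNew hn h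
        linarith
    by_cases h : lastEdge A ∉ B.1.edgeSet ∧ 2 ≤ numComp (red hn A) B
    · obtain ⟨C, hC, hlt⟩ := exists_numComp_lt hn A B h.1 h.2
      rw [if_pos h.2, if_neg h.1]
      have hlt' : (numComp A C : ℝ) + 1 ≤ numComp (red hn A) B := by exact_mod_cast hlt
      have hnew : (0 : ℝ) ≤ if IsNew hn A C then 1 else 0 := by split_ifs <;> norm_num
      have hsum := Finset.single_le_sum
        (f := fun C => (numComp (red hn A) B : ℝ) -
          ((numComp A C : ℝ) - if IsNew hn A C then 1 else 0))
        (fun D hD => sub_nonneg.2 (hle D hD)) hC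
      rw [Finset.sum_sub_distrib, Finset.sum_const, card_fiber, nsmul_eq_mul] at hsum
      linarith
    · have hsum := Finset.sum_le_sum hle
      rw [Finset.sum_const, card_fiber, nsmul_eq_mul] at hsum
      have : ((if 2 ≤ numComp (red hn A) B then 1 else 0) : ℝ) ≤
          if lastEdge A ∈ B.1.edgeSet then 1 else 0 := by
        by_cases h' : lastEdge A ∈ B.1.edgeSet
        · rw [if_pos h']
          split_ifs <;> norm_num
        · rw [if_neg h', if_neg fun h2 => h ⟨h', h2⟩]
      linarith
  rw [avg_sub, avg_sub, avg_mul, avg_sub, ← prob_eq, ← prob_eq, ← prob_eq] at h1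
  have h2 := prob_isNew_le hn A
  have h3 := prob_mem_edgeSet_le hn (lastEdge A)
  have h4 : (1 / n : ℝ) * prob (fun B : CycleOn n => lastEdge A ∈ B.1.edgeSet) ≤
      2 / ((n - 1) * (n - 2)) := by
    refine (mul_le_mul_of_nonneg_left h3 (by positivity)).trans ?_
    rw [div_mul_div_comm, one_mul]
    refine div_le_div_of_nonneg_left (by norm_num) (mul_pos (by linarith) (by linarith)) ?_
    nlinarith
  have h5 : (6 : ℝ) / ((n - 1) * (n - 2)) =
      4 / ((n - 1) * (n - 2)) + 2 / ((n - 1) * (n - 2)) := by ring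
  rw [h5, div_eq_inv_mul (prob _), ← one_div]
  linarith

/-- Taking for `p` the probability of more than one component at the final stage, this bounds the
harmonic sum. The term `4 / (n - 2)` in the hypothesis bounds the probability that components are
created after stage `n`, so that the hypothesis passes from `n + 1` to `n`; the term `10 / (n - 2)`
telescopes the errors `6 / ((n - 1) (n - 2))` and `4 / ((n - 1) (n - 2))` of the drift. -/
theorem avg_numComp_le {n : ℕ} (A : CycleOn n) {p : ℝ}
    (hp : p ≤ prob (fun B => 2 ≤ numComp A B) + 4 / (n - 2)) :
    avg (fun B => (numComp A B : ℝ)) + 10 / (n - 2) ≤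
      10 - p * ∑ i ∈ Finset.Ico 3 n, 1 / (i : ℝ) := by
  have hn := A.three_le
  induction n, hn using Nat.le_induction with
  | base =>
    have : avg (fun B => (numComp A B : ℝ)) ≤ 0 := by
      refine avg_le_of_le le_rfl fun B => ?_
      have : IsEmpty (pedigreeVertices A B) :=
        ⟨fun x => x.2.2 (congrArg (nu · x.1) (Subsingleton.elim A B))⟩
      have : IsEmpty (pedigreeGraph A B).ConnectedComponent :=
        ⟨fun c => c.ind fun x => isEmptyElim x⟩
      simp [numComp]
    norm_num
    linarith
  | succ n hn ih =>
    have hn3 : (3 : ℝ) ≤ n := by exact_mod_cast hn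
    have hn0 : (n : ℝ) ≠ 0 := by linarith
    have hn1 : (n : ℝ) - 1 ≠ 0 := by linarith
    have hn2 : (n : ℝ) - 2 ≠ 0 := by linarith
    have hn21 : ((n + 1 : ℕ) : ℝ) - 2 = n - 1 := by
      push_cast
      ring
    rw [hn21] at hp ⊢
    have htel : ∀ c : ℝ, c / (n - 1) + c / ((n - 1) * (n - 2)) = c / (n - 2) := by
      intro c
      field_simp
      ring
    have hp' : p ≤ prob (fun B => 2 ≤ numComp (red hn A) B) + 4 / (n - 2) := by
      have := prob_two_le_numComp_succ_le hn A
      have := htel 4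
      linarith
    have h1 := ih (red hn A) hp'
    have h2 := avg_numComp_succ_le hn A
    have h3 : p / n ≤ prob (fun B => 2 ≤ numComp (red hn A) B) / n +
        4 / ((n - 1) * (n - 2)) := by
      refine (div_le_div_of_nonneg_right hp' (by linarith)).trans ?_
      rw [add_div, div_div, mul_comm ((n : ℝ) - 2)]
      gcongr
      · exact mul_pos (by linarith) (by linarith)
      · linarith
      · linarith
    rw [Finset.sum_Ico_succ_top hn, mul_add, mul_one_div]
    have h4 := htel 10
    have h5 : (10 : ℝ) / ((n - 1) * (n - 2)) =
        6 / ((n - 1) * (n - 2)) + 4 / ((n - 1) * (n - 2)) := by ring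
    linarith

theorem prob_two_le_numComp_mul_sum_le {n : ℕ} (A : CycleOn n) :
    prob (fun B => 2 ≤ numComp A B) * ∑ i ∈ Finset.Ico 3 n, 1 / (i : ℝ) ≤ 10 := by
  have hn3 : (3 : ℝ) ≤ n := by exact_mod_cast A.three_le
  have h := avg_numComp_le A (p := prob (fun B => 2 ≤ numComp A B))
    (le_add_of_nonneg_right (div_nonneg (by norm_num) (by linarith)))
  have h1 : 0 ≤ avg (fun B => (numComp A B : ℝ)) := avg_nonneg fun B => Nat.cast_nonneg _
  have h2 : (0 : ℝ) ≤ 10 / (n - 2) := div_nonneg (by norm_num) (by linarith)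
  linarith

/-! ### Connectedness with high probability -/

theorem le_card_cycleOn {n : ℕ} (hn : 3 ≤ n) (A : CycleOn (n + 1)) :
    n ≤ Fintype.card (CycleOn (n + 1)) := by
  rw [card_cycleOn_succ hn]
  exact Nat.le_mul_of_pos_right n (Fintype.card_pos_iff.2 ⟨red hn A⟩)

theorem uniformOn_univ_real_eq_prob {n : ℕ} (s : Set (CycleOn n)) :
    (ProbabilityTheory.uniformOn (Set.univ : Set (CycleOn n))).real s = prob (· ∈ s) := by
  classical
  have hs : MeasurableSet s := MeasurableSpace.measurableSet_top
  rw [prob_eq, avg, Finset.sum_boole, MeasureTheory.measureReal_def,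
    ProbabilityTheory.uniformOn_univ, MeasureTheory.Measure.count_apply hs,
    ENNReal.toReal_div, Set.encard_eq_coe_toFinset_card]
  simp [Set.toFinset_card, Fintype.card_subtype]

theorem connected_of_numComp_lt_two {n : ℕ} {A B : CycleOn n} (hAB : A ≠ B)
    (h : numComp A B < 2) : (pedigreeGraph A B).Connected := by
  have hsub : Subsingleton (pedigreeGraph A B).ConnectedComponent :=
    Finite.card_le_one_iff_subsingleton.1 (Nat.le_of_lt_succ h)
  obtain ⟨x, hx⟩ := Set.nonempty_iff_ne_empty.2 fun h => hAB (eq_of_pedigreeVertices_eq_empty h)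
  exact (SimpleGraph.connected_iff _).2
    ⟨fun u v => SimpleGraph.ConnectedComponent.exact (Subsingleton.elim _ _), ⟨⟨x, hx⟩⟩⟩

theorem one_sub_le_prob_connected {n : ℕ} (A : CycleOn n) :
    1 - prob (fun B => 2 ≤ numComp A B) - 1 / Fintype.card (CycleOn n) ≤
      prob fun B => (pedigreeGraph A B).Connected := by
  classical
  have hpos : 0 < Fintype.card (CycleOn n) := Fintype.card_pos_iff.2 ⟨A⟩
  have h1 : avg (fun _ : CycleOn n => (1 : ℝ)) = 1 := by
    simp [avg, hpos.ne']
  have h2 : avg (fun B => if A = B then (1 : ℝ) else 0) = 1 / Fintype.card (CycleOn n) := by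
    simp [avg]
  rw [← h2, prob_eq, prob_eq fun B => (pedigreeGraph A B).Connected]
  nth_rewrite 1 [← h1]
  rw [← avg_sub, ← avg_sub]
  refine avg_mono fun B => ?_
  by_cases hAB : A = B
  · rw [if_pos hAB]
    split_ifs <;> norm_num
  · by_cases hK : 2 ≤ numComp A B
    · rw [if_pos hK]
      split_ifs <;> norm_num
    · rw [if_pos (connected_of_numComp_lt_two hAB (not_le.1 hK)), if_neg hAB, if_neg hK]
      norm_num

theorem tendsto_sum_Ico_three_one_div :
    Filter.Tendsto (fun n : ℕ => ∑ i ∈ Finset.Ico 3 n, 1 / (i : ℝ)) Filter.atTop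
      Filter.atTop := by
  have h := (not_summable_iff_tendsto_nat_atTop_of_nonneg
    (f := fun i : ℕ => 1 / (i : ℝ)) fun i => by positivity).1 Real.not_summable_one_div_natCast
  refine (Filter.tendsto_atTop_add_const_right _ (-∑ i ∈ Finset.range 3, 1 / (i : ℝ)) h).congr' ?_
  filter_upwards [Filter.eventually_ge_atTop 3] with n hn
  rw [Finset.sum_Ico_eq_sub _ hn, sub_eq_add_neg]

end Pedigree

theorem theorem3 (ε : ℝ) (hε : 0 < ε) :
    ∃ N : ℕ, ∀ n : ℕ, N ≤ n → ∀ A : Pedigree.CycleOn n,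
      1 - ε ≤ (ProbabilityTheory.uniformOn (Set.univ : Set (Pedigree.CycleOn n))).real
        {B | (Pedigree.pedigreeGraph A B).Connected} := by
  obtain ⟨N₁, hN₁⟩ := Filter.eventually_atTop.1
    (Pedigree.tendsto_sum_Ico_three_one_div.eventually_ge_atTop (20 / ε))
  obtain ⟨N₂, hN₂⟩ := exists_nat_ge (2 / ε)
  refine ⟨max N₁ (N₂ + 4), fun n hn A => ?_⟩
  have hsum := hN₁ n ((le_max_left _ _).trans hn)
  have hn₂ := (le_max_right _ _).trans hn
  rw [Pedigree.uniformOn_univ_real_eq_prob]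
  refine le_trans ?_ (Pedigree.one_sub_le_prob_connected A)
  have h1 : Pedigree.prob (fun B => 2 ≤ Pedigree.numComp A B) ≤ ε / 2 := by
    have h := (mul_le_mul_of_nonneg_left hsum (Pedigree.prob_nonneg _)).trans
      (Pedigree.prob_two_le_numComp_mul_sum_le A)
    rw [← mul_div_assoc, div_le_iff₀ hε] at h
    linarith
  have h2 : (1 : ℝ) / Fintype.card (Pedigree.CycleOn n) ≤ ε / 2 := by
    obtain ⟨m, rfl⟩ : ∃ m, n = m + 1 := ⟨n - 1, by omega⟩
    have hcard : (N₂ : ℝ) ≤ Fintype.card (Pedigree.CycleOn (m + 1)) := by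
      exact_mod_cast (show N₂ ≤ m by omega).trans (Pedigree.le_card_cycleOn (by omega) A)
    have h := hN₂.trans hcard
    rw [div_le_iff₀ hε] at h
    have hpos : (0 : ℝ) < Fintype.card (Pedigree.CycleOn (m + 1)) :=
      Nat.cast_pos.2 (Fintype.card_pos_iff.2 ⟨A⟩)
    rw [div_le_iff₀ hpos]
    linarith
  linarith
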